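/- Let $\mathsf{CHausStoch}$ be the Markov category whose objects are compact Hausdorff spaces and whose morphisms $X\to Y$ are the continuous Markov kernels, i.e. the maps $x\mapsto k(\,\cdot\,|x)$ from $X$ to Radon probability measures on $Y$ that are continuous for the weak topology (for every continuous $\varphi\colon Y\to\mathbb{R}$, the function $x\mapsto\int_Y\varphi(y)\,k(dy|x)$ is continuous). Composition is $(g\circ f)(B|x)=\int g(B|y)\,f(dy|x)$, the tensor product is the cartesian product of spaces with the Radon product of kernels, and $\mathrm{copy}_X\colon X\to X\otimes X$ is the deterministic kernel $x\mapsto\delta_{(x,x)}$. Let $X$ be a compact Hausdorff space and let $e\colon X\to X$ be an idempotent in $\mathsf{CHausStoch}$, i.e. $e\circ e=e$. Then: 1. $e$ is balanced: $(e\otimes \mathrm{id}_X)\circ \mathrm{copy}_X\circ e=(e\otimes e)\circ \mathrm{copy}_X\circ e$; 2. $e$ splits: there are a compact Hausdorff space $T$ and morphisms $\pi\colon X\to T$ and $\iota\colon T\to X$ in $\mathsf{CHausStoch}$ such that $\iota\circ\pi=e$ and $\pi\circ\iota=\mathrm{id}_T$. -/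

import Mathlib

open CategoryTheory

universe u

set_option linter.unusedSectionVars false

noncomputable section

/-- Compact Hausdorff spaces, the objects of the category `CHausStoch` of compact Hausdorff spaces
and continuous Markov kernels. -/
structure CHausStoch : Type (u + 1) where
  of ::
  /-- The underlying type. -/
  carrier : Type u
  [top : TopologicalSpace carrier]
  [compact : CompactSpace carrier]
  [t2 : T2Space carrier]

namespace CHausStoch

open MeasureTheory ProbabilityTheory MonoidalCategory
open scoped ENNReal

/-! ### Radon measures and continuous kernels on compact Hausdorff spaces -/

section Radon

variable {X Y Z : Type*}
  [TopologicalSpace X] [CompactSpace X] [T2Space X] [MeasurableSpace X] [BorelSpace X]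
  [TopologicalSpace Y] [CompactSpace Y] [T2Space Y] [MeasurableSpace Y] [BorelSpace Y]
  [TopologicalSpace Z] [CompactSpace Z] [T2Space Z] [MeasurableSpace Z] [BorelSpace Z]

lemma integrable_continuousMap (μ : Measure X) [IsFiniteMeasure μ] (φ : C(X, ℝ)) :
    Integrable φ μ :=
  φ.continuous.integrable_of_hasCompactSupport (HasCompactSupport.of_compactSpace _)

lemma ext_of_integral {μ ν : Measure X} [μ.Regular] [ν.Regular]
    (h : ∀ φ : C(X, ℝ), ∫ x, φ x ∂μ = ∫ x, φ x ∂ν) : μ = ν :=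
  Measure.ext_of_integral_eq_on_compactlySupported fun f => h f.toContinuousMap

/-- On a compact Hausdorff space, inner regularity on open sets by closed sets suffices for a
finite Borel measure to be Radon. -/
lemma regular_of_innerRegularWRT (μ : Measure X) [IsFiniteMeasure μ]
    (H : μ.InnerRegularWRT IsClosed IsOpen) : μ.Regular := by
  have := Measure.InnerRegularWRT.weaklyRegular_of_finite μ H
  exact { innerRegular := fun U hU r hr => by
            obtain ⟨K, hKU, hK, hr⟩ := H hU r hr
            exact ⟨K, hKU, hK.isCompact, hr⟩ }

lemma regular_map (μ : Measure X) [IsFiniteMeasure μ] [μ.Regular] (h : C(X, Y)) :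
    (μ.map h).Regular := by
  have : IsFiniteMeasure (μ.map h) := Measure.isFiniteMeasure_map μ h
  apply regular_of_innerRegularWRT
  intro U hU r hr
  rw [Measure.map_apply h.continuous.measurable hU.measurableSet] at hr
  obtain ⟨K, hKU, hK, hr⟩ := (hU.preimage h.continuous).exists_lt_isCompact hr
  refine ⟨h '' K, by simpa using hKU, (hK.image h.continuous).isClosed, ?_⟩
  rw [Measure.map_apply h.continuous.measurable (hK.image h.continuous).isClosed.measurableSet]
  exact hr.trans_le (measure_mono (Set.subset_preimage_image _ _))

/-- The mass of an open set is approximated by integrals of continuous functions dominated by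
the indicator of a closed subset. -/
lemma exists_lt_integral (μ : Measure X) [IsFiniteMeasure μ] [μ.Regular] {U : Set X}
    (hU : IsOpen U) {r : ℝ≥0∞} (hr : r < μ U) :
    ∃ (K : Set X) (φ : C(X, ℝ)), IsClosed K ∧ K ⊆ U ∧ (∀ x, 0 ≤ φ x) ∧
      (∀ x, φ x ≤ K.indicator 1 x) ∧ r < ENNReal.ofReal (∫ x, φ x ∂μ) := by
  obtain ⟨K, hKU, hK, hr⟩ := hU.exists_lt_isCompact hr
  obtain ⟨φ, h1, h2, h3⟩ := exists_tsupport_one_of_isOpen_isClosed hU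
    isClosed_closure.isCompact hK.isClosed hKU
  refine ⟨tsupport φ, φ, isClosed_tsupport _, h1, fun x => (h3 x).1, fun x => ?_, ?_⟩
  · by_cases hx : x ∈ tsupport φ
    · simpa [hx] using (h3 x).2
    · simp [hx, image_eq_zero_of_notMem_tsupport hx]
  · refine hr.trans_le ?_
    rw [ofReal_integral_eq_lintegral_ofReal (integrable_continuousMap μ φ)
      (Filter.Eventually.of_forall fun x => (h3 x).1), ← lintegral_indicator_one hK.measurableSet]
    refine lintegral_mono fun x => ?_
    by_cases hx : x ∈ K
    · simp [hx, h2 hx]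
    · simp [hx]

lemma integral_le_of_le_indicator (μ : Measure X) [IsFiniteMeasure μ] {K : Set X}
    (hK : IsClosed K) {φ : C(X, ℝ)} (h0 : ∀ x, 0 ≤ φ x) (h : ∀ x, φ x ≤ K.indicator 1 x) :
    ENNReal.ofReal (∫ x, φ x ∂μ) ≤ μ K := by
  rw [ofReal_integral_eq_lintegral_ofReal (integrable_continuousMap μ φ)
      (Filter.Eventually.of_forall h0), ← lintegral_indicator_one hK.measurableSet]
  refine lintegral_mono fun x => ?_
  by_cases hx : x ∈ K
  · simpa [hx] using h x
  · simpa [hx] using h x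

/-- Weakly continuous families of Radon probability measures are lower semicontinuous on
open sets. -/
lemma lowerSemicontinuous_apply {κ : X → Measure Y} (hp : ∀ x, IsProbabilityMeasure (κ x))
    (hr : ∀ x, (κ x).Regular) (hc : ∀ φ : C(Y, ℝ), Continuous fun x => ∫ y, φ y ∂κ x)
    {U : Set Y} (hU : IsOpen U) : LowerSemicontinuous fun x => κ x U := by
  intro x r hxr
  have := hp x
  have := hr x
  obtain ⟨K, φ, hK, hKU, h0, h1, hlt⟩ := exists_lt_integral (κ x) hU hxr
  have hcont : Continuous fun x => ENNReal.ofReal (∫ y, φ y ∂κ x) :=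
    ENNReal.continuous_ofReal.comp (hc φ)
  filter_upwards [hcont.continuousAt.eventually (lt_mem_nhds hlt)] with z hz
  have := hp z
  exact hz.trans_le ((integral_le_of_le_indicator (κ z) hK h0 h1).trans (measure_mono hKU))

/-- Weakly continuous families of Radon probability measures are measurable. -/
lemma measurable_of_continuous {κ : X → Measure Y} (hp : ∀ x, IsProbabilityMeasure (κ x))
    (hr : ∀ x, (κ x).Regular) (hc : ∀ φ : C(Y, ℝ), Continuous fun x => ∫ y, φ y ∂κ x) :
    Measurable κ :=
  Measurable.measure_of_isPiSystem_of_isProbabilityMeasure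
    (BorelSpace.measurable_eq (α := Y)) isPiSystem_isOpen
    fun _ hU => (lowerSemicontinuous_apply hp hr hc hU).measurable

/-- Averaging a weakly continuous family of Radon probability measures against a Radon
probability measure gives a Radon measure. -/
lemma regular_bind (μ : Measure X) [IsProbabilityMeasure μ] [μ.Regular] {κ : X → Measure Y}
    (hp : ∀ x, IsProbabilityMeasure (κ x)) (hr : ∀ x, (κ x).Regular)
    (hc : ∀ φ : C(Y, ℝ), Continuous fun x => ∫ y, φ y ∂κ x) : (μ.bind κ).Regular := by
  have hm := measurable_of_continuous hp hr hc
  have hb (s : Set Y) (hs : MeasurableSet s) : μ.bind κ s = ∫⁻ x, κ x s ∂μ :=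
    Measure.bind_apply hs hm.aemeasurable
  have : IsFiniteMeasure (μ.bind κ) := ⟨by simp [hb _ MeasurableSet.univ]⟩
  apply regular_of_innerRegularWRT
  intro U hU r hlt
  obtain ⟨ε, hε, hlt⟩ : ∃ ε : NNReal, 0 < ε ∧ r + (ε + ε) < μ.bind κ U := by
    obtain ⟨δ, hδ, h⟩ := ENNReal.lt_iff_exists_add_pos_lt.1 hlt
    refine ⟨δ / 2, half_pos hδ, ?_⟩
    rwa [← ENNReal.coe_add, add_halves]
  have hF (x : X) : (((κ x U).toNNReal : NNReal) : ℝ≥0∞) = κ x U :=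
    ENNReal.coe_toNNReal (measure_ne_top _ _)
  obtain ⟨g, hgF, hg, hgint⟩ := exists_upperSemicontinuous_le_lintegral_le (μ := μ)
    (fun x => (κ x U).toNNReal) (by simp only [hF, ← hb U hU.measurableSet]; finiteness)
    (ε := ε) (by simpa using hε.ne')
  simp only [hF, ← hb U hU.measurableSet] at hgint
  -- pointwise approximation from inside, then compactness
  have key (x : X) : ∃ (K : Set Y) (φ : C(Y, ℝ)), IsClosed K ∧ K ⊆ U ∧ (∀ y, 0 ≤ φ y) ∧
      (∀ y, φ y ≤ K.indicator 1 y) ∧ (g x : ℝ) < ∫ y, φ y ∂κ x + ε := by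
    by_cases h0 : κ x U = 0
    · refine ⟨∅, 0, isClosed_empty, by simp, by simp, by simp, ?_⟩
      have : g x = 0 := by simpa [h0] using hgF x
      simpa [this] using hε
    · obtain ⟨K, φ, hK, hKU, hp0, hp1, hl⟩ := exists_lt_integral (κ x) hU
        (r := κ x U - ε) (ENNReal.sub_lt_self (by finiteness) h0 (by simpa using hε.ne'))
      refine ⟨K, φ, hK, hKU, hp0, hp1, ?_⟩
      have hn : 0 ≤ ∫ y, φ y ∂κ x := integral_nonneg hp0
      have h2 : κ x U < ENNReal.ofReal (∫ y, φ y ∂κ x) + ε := by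
        rcases le_or_gt (ε : ℝ≥0∞) (κ x U) with hle | hgt
        · exact (ENNReal.sub_lt_iff_lt_right ENNReal.coe_ne_top hle).1 hl
        · exact hgt.trans_le le_add_self
      have h3 : ENNReal.ofReal (g x : ℝ) < ENNReal.ofReal (∫ y, φ y ∂κ x + ε) := by
        rw [ENNReal.ofReal_add hn ε.coe_nonneg, ENNReal.ofReal_coe_nnreal, ENNReal.ofReal_coe_nnreal]
        refine lt_of_le_of_lt ?_ h2
        rw [← hF x]
        exact_mod_cast hgF x
      exact (ENNReal.ofReal_lt_ofReal_iff_of_nonneg (g x).coe_nonneg).1 h3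
  choose K φ hK hKU h0 h1 hlt' using key
  have hopen (x : X) : IsOpen {z | (g z : ℝ) < ∫ y, φ x y ∂κ z + ε} := by
    have hg' : UpperSemicontinuous fun z => (g z : ℝ) :=
      NNReal.continuous_coe.comp_upperSemicontinuous hg NNReal.coe_mono
    have : UpperSemicontinuous fun z => (g z : ℝ) + -∫ y, φ x y ∂κ z :=
      hg'.add (hc (φ x)).neg.upperSemicontinuous
    convert this.isOpen_preimage (ε : ℝ) using 1
    ext z
    simp only [Set.mem_ofPred_eq, Set.mem_preimage, Set.mem_Iio]
    constructor <;> intro h <;> linarith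
  obtain ⟨t, ht⟩ := isCompact_univ.elim_finite_subcover _ hopen
    fun x _ => Set.mem_iUnion.2 ⟨x, hlt' x⟩
  have hKc : IsClosed (⋃ x ∈ t, K x) := t.finite_toSet.isClosed_biUnion fun x _ => hK x
  refine ⟨⋃ x ∈ t, K x, Set.iUnion₂_subset fun x _ => hKU x, hKc, ?_⟩
  have hgK (z : X) : (g z : ℝ≥0∞) ≤ κ z (⋃ x ∈ t, K x) + ε := by
    obtain ⟨x, hx, hz⟩ := Set.mem_iUnion₂.1 (ht (Set.mem_univ z))
    have hn : 0 ≤ ∫ y, φ x y ∂κ z := integral_nonneg (h0 x)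
    calc (g z : ℝ≥0∞) = ENNReal.ofReal (g z : ℝ) := by rw [ENNReal.ofReal_coe_nnreal]
      _ ≤ ENNReal.ofReal (∫ y, φ x y ∂κ z + ε) := ENNReal.ofReal_le_ofReal (le_of_lt hz)
      _ = ENNReal.ofReal (∫ y, φ x y ∂κ z) + ε := by
        rw [ENNReal.ofReal_add hn ε.coe_nonneg, ENNReal.ofReal_coe_nnreal]
      _ ≤ κ z (⋃ x ∈ t, K x) + ε := by
        gcongr
        exact (integral_le_of_le_indicator (κ z) (hK x) (h0 x) (h1 x)).trans
          (measure_mono (Set.subset_biUnion_of_mem hx))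
  have hle : μ.bind κ U ≤ μ.bind κ (⋃ x ∈ t, K x) + (ε + ε) := by
    calc μ.bind κ U ≤ ∫⁻ x, g x ∂μ + ε := hgint
      _ ≤ ∫⁻ x, (κ x (⋃ x ∈ t, K x) + ε) ∂μ + ε := by gcongr with z; exact hgK z
      _ = μ.bind κ (⋃ x ∈ t, K x) + (ε + ε) := by
        rw [lintegral_add_right _ measurable_const, ← hb _ hKc.measurableSet]
        simp [add_assoc]
  exact lt_of_add_lt_add_right (hlt.trans_le hle)

lemma dist_integral_le (μ : Measure X) [IsProbabilityMeasure μ] (φ ψ : C(X, ℝ)) :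
    dist (∫ x, φ x ∂μ) (∫ x, ψ x ∂μ) ≤ dist φ ψ := by
  rw [Real.dist_eq, ← integral_sub (integrable_continuousMap μ φ) (integrable_continuousMap μ ψ),
    ← Real.norm_eq_abs]
  refine (norm_integral_le_of_norm_le_const (C := dist φ ψ)
    (Filter.Eventually.of_forall fun x => ?_)).trans (by simp)
  rw [Real.norm_eq_abs, ← Real.dist_eq]
  exact ContinuousMap.dist_apply_le_dist x

lemma continuous_integral (μ : Measure X) [IsProbabilityMeasure μ] :
    Continuous fun φ : C(X, ℝ) => ∫ x, φ x ∂μ :=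
  (LipschitzWith.of_dist_le_mul (K := 1) fun φ ψ => by
    simpa using dist_integral_le μ φ ψ).continuous

lemma exists_continuousMap_ne {a b : X} (hab : a ≠ b) : ∃ φ : C(X, ℝ), φ a ≠ φ b := by
  obtain ⟨φ, h0, h1, -⟩ := exists_continuous_zero_one_of_isClosed
    (isClosed_singleton (x := a)) (isClosed_singleton (x := b)) (by simpa using hab)
  refine ⟨φ, ?_⟩
  rw [h0 rfl, h1 rfl]
  simp

/-- Radon probability measures on a product of compact Hausdorff spaces are determined by
the integrals of products of continuous functions on the factors. -/
lemma ext_of_integral_mul {μ ν : Measure Z} [IsProbabilityMeasure μ] [IsProbabilityMeasure ν]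
    [μ.Regular] [ν.Regular] (p : C(Z, X)) (q : C(Z, Y))
    (hpq : ∀ z w, p z = p w → q z = q w → z = w)
    (h : ∀ (φ : C(X, ℝ)) (ψ : C(Y, ℝ)), ∫ z, φ (p z) * ψ (q z) ∂μ = ∫ z, φ (p z) * ψ (q z) ∂ν) :
    μ = ν := by
  let M : Submonoid C(Z, ℝ) :=
    { carrier := {χ | ∃ (φ : C(X, ℝ)) (ψ : C(Y, ℝ)), χ = φ.comp p * ψ.comp q}
      one_mem' := ⟨1, 1, by ext; simp⟩
      mul_mem' := by
        rintro _ _ ⟨φ, ψ, rfl⟩ ⟨φ', ψ', rfl⟩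
        exact ⟨φ * φ', ψ * ψ', by ext; simp; ring⟩ }
  have hsep : (Algebra.adjoin ℝ (M : Set C(Z, ℝ))).SeparatesPoints := by
    intro z w hzw
    have : p z ≠ p w ∨ q z ≠ q w := by
      by_contra hcon
      push Not at hcon
      exact hzw (hpq z w hcon.1 hcon.2)
    rcases this with hp | hq
    · obtain ⟨φ, hφ⟩ := exists_continuousMap_ne hp
      exact ⟨_, ⟨φ.comp p, Algebra.subset_adjoin ⟨φ, 1, by ext; simp⟩, rfl⟩, by simpa using hφ⟩
    · obtain ⟨φ, hφ⟩ := exists_continuousMap_ne hq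
      exact ⟨_, ⟨φ.comp q, Algebra.subset_adjoin ⟨1, φ, by ext; simp⟩, rfl⟩, by simpa using hφ⟩
  have hdense := ContinuousMap.subalgebra_topologicalClosure_eq_top_of_separatesPoints _ hsep
  have hclosed : IsClosed {χ : C(Z, ℝ) | ∫ z, χ z ∂μ = ∫ z, χ z ∂ν} :=
    isClosed_eq (continuous_integral μ) (continuous_integral ν)
  refine ext_of_integral fun χ => ?_
  have hsub : ((Algebra.adjoin ℝ (M : Set C(Z, ℝ)) : Subalgebra ℝ C(Z, ℝ)) : Set C(Z, ℝ)) ⊆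
      {χ : C(Z, ℝ) | ∫ z, χ z ∂μ = ∫ z, χ z ∂ν} := by
    intro χ hχ
    have hχ' : χ ∈ Submodule.span ℝ (M : Set C(Z, ℝ)) := by
      have := Algebra.adjoin_eq_span (R := ℝ) (s := (M : Set C(Z, ℝ)))
      rw [Submonoid.closure_eq] at this
      rw [← this]
      exact hχ
    clear hχ
    induction hχ' using Submodule.span_induction with
    | mem χ hχ =>
      obtain ⟨φ, ψ, rfl⟩ := hχ
      exact h φ ψ
    | zero => simp
    | add χ χ' _ _ h1 h2 =>
      simp only [Set.mem_ofPred_eq, ContinuousMap.add_apply] at h1 h2 ⊢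
      rw [integral_add (integrable_continuousMap μ χ) (integrable_continuousMap μ χ'),
        integral_add (integrable_continuousMap ν χ) (integrable_continuousMap ν χ'), h1, h2]
    | smul c χ _ h1 =>
      simp only [Set.mem_ofPred_eq, ContinuousMap.smul_apply, integral_smul] at h1 ⊢
      rw [h1]
  have : χ ∈ (Algebra.adjoin ℝ (M : Set C(Z, ℝ))).topologicalClosure := by
    rw [hdense]; trivial
  exact closure_minimal hsub hclosed this

end Radon

/-! ### The category of compact Hausdorff spaces and continuous Markov kernels -/

attribute [instance] top compact t2

instance : CoeSort CHausStoch.{u} (Type u) := ⟨carrier⟩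

/-- Every space is equipped with its Borel `σ`-algebra. -/
instance (X : CHausStoch.{u}) : MeasurableSpace X := borel X

instance (X : CHausStoch.{u}) : BorelSpace X := ⟨rfl⟩

/-- A morphism is a Markov kernel whose values are Radon probability measures and which is
continuous for the weak topology on Radon probability measures. -/
@[ext]
structure Hom (X Y : CHausStoch.{u}) where
  /-- The underlying kernel. -/
  kernel : Kernel X Y
  isMarkov : IsMarkovKernel kernel
  regular : ∀ x, (kernel x).Regular
  continuous_integral : ∀ φ : C(Y, ℝ), Continuous fun x => ∫ y, φ y ∂kernel x

attribute [instance] Hom.isMarkov Hom.regular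

namespace Hom

variable {X Y Z : CHausStoch.{u}}

/-- Integration of continuous functions against a continuous kernel. -/
def pull (f : Hom X Y) : C(C(Y, ℝ), C(X, ℝ)) where
  toFun φ := ⟨fun x => ∫ y, φ y ∂f.kernel x, f.continuous_integral φ⟩
  continuous_toFun := (LipschitzWith.of_dist_le_mul (K := 1) fun φ ψ => by
    rw [NNReal.coe_one, one_mul, ContinuousMap.dist_le dist_nonneg]
    exact fun x => dist_integral_le (f.kernel x) φ ψ).continuous

lemma pull_apply (f : Hom X Y) (φ : C(Y, ℝ)) (x : X) :
    f.pull φ x = ∫ y, φ y ∂f.kernel x := rfl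

lemma ext_pull {f g : Hom X Y} (h : ∀ φ x, f.pull φ x = g.pull φ x) : f = g := by
  ext x : 2
  exact ext_of_integral fun φ => h φ x

/-- Constructor for morphisms; measurability is automatic. -/
def ofMeasure (κ : X → Measure Y) (hp : ∀ x, IsProbabilityMeasure (κ x))
    (hr : ∀ x, (κ x).Regular) (hc : ∀ φ : C(Y, ℝ), Continuous fun x => ∫ y, φ y ∂κ x) :
    Hom X Y where
  kernel := ⟨κ, measurable_of_continuous hp hr hc⟩
  isMarkov := ⟨hp⟩
  regular := hr
  continuous_integral := hc

/-- The deterministic kernel of a continuous map. -/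
def det (h : C(X, Y)) : Hom X Y where
  kernel := Kernel.deterministic h h.continuous.measurable
  isMarkov := inferInstance
  regular x := by
    rw [Kernel.deterministic_apply]
    apply regular_of_innerRegularWRT
    intro U hU r hr
    by_cases hx : h x ∈ U
    · refine ⟨{h x}, by simpa using hx, isClosed_singleton, ?_⟩
      simpa [Measure.dirac_apply' _ hU.measurableSet, hx] using hr
    · simp [Measure.dirac_apply' _ hU.measurableSet, hx] at hr
  continuous_integral φ := by
    simp only [Kernel.deterministic_apply, integral_dirac]
    exact φ.continuous.comp h.continuous

@[simp]
lemma det_pull (h : C(X, Y)) (φ : C(Y, ℝ)) (x : X) : (det h).pull φ x = φ (h x) := by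
  simp [pull_apply, det, Kernel.deterministic_apply]

lemma comp_det_pull (f : Hom X Y) (h : C(Y, Z)) (φ : C(Z, ℝ)) (x : X) :
    f.pull ((det h).pull φ) x = f.pull (φ.comp h) x :=
  congrArg (fun ψ => f.pull ψ x) (ContinuousMap.ext fun y => det_pull h φ y)

lemma id_pull (φ : C(X, ℝ)) : (det (.id X)).pull φ = φ := by
  ext x
  simp

/-- Composition of kernels. -/
def comp (f : Hom X Y) (g : Hom Y Z) : Hom X Z where
  kernel := g.kernel ∘ₖ f.kernel
  isMarkov := inferInstance
  regular x := by
    rw [Kernel.comp_apply]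
    exact regular_bind _ (fun _ => inferInstance) g.regular g.continuous_integral
  continuous_integral φ := by
    simp_rw [Kernel.integral_comp (integrable_continuousMap ((g.kernel ∘ₖ f.kernel) _) φ)]
    exact f.continuous_integral (g.pull φ)

@[simp]
lemma comp_pull (f : Hom X Y) (g : Hom Y Z) (φ : C(Z, ℝ)) (x : X) :
    (f.comp g).pull φ x = f.pull (g.pull φ) x :=
  Kernel.integral_comp (integrable_continuousMap ((g.kernel ∘ₖ f.kernel) x) φ)

end Hom

instance : LargeCategory CHausStoch.{u} where
  Hom := Hom
  id X := Hom.det (.id X)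
  comp := Hom.comp
  id_comp f := Hom.ext_pull fun φ x => by simp
  comp_id f := Hom.ext_pull fun φ x => by
    rw [Hom.comp_pull, Hom.id_pull]
  assoc f g h := Hom.ext (Kernel.comp_assoc _ _ _).symm

/-! ### The monoidal structure -/

/-- The product of two spaces, with its Borel `σ`-algebra. -/
def prod (X Y : CHausStoch.{u}) : CHausStoch.{u} := of (X × Y)

section prod

variable {X X' Y Y' Z : CHausStoch.{u}}

/-- The projections and the pairing of a product. -/
def fst : C(prod X Y, X) := ⟨fun p => Prod.fst (α := X) (β := Y) p, continuous_fst⟩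

def snd : C(prod X Y, Y) := ⟨fun p => Prod.snd (α := X) (β := Y) p, continuous_snd⟩

def lift (h : C(Z, X)) (k : C(Z, Y)) : C(Z, prod X Y) := h.prodMk k

/-- The identity map, from the product of types. -/
def toProd : C(X × Y, prod X Y) := .id (X × Y)

lemma measurable_toProd (a : X) : Measurable fun b : Y => toProd (a, b) :=
  (toProd.continuous.comp (Continuous.prodMk_right a)).measurable

lemma prod_ext {p q : prod X Y} (h1 : fst p = fst q) (h2 : snd p = snd q) : p = q :=
  Prod.ext h1 h2

@[simp] lemma fst_toProd (p : X × Y) : fst (toProd p) = p.1 := rfl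
@[simp] lemma snd_toProd (p : X × Y) : snd (toProd p) = p.2 := rfl
@[simp] lemma fst_lift (h : C(Z, X)) (k : C(Z, Y)) (z : Z) : fst (lift h k z) = h z := rfl
@[simp] lemma snd_lift (h : C(Z, X)) (k : C(Z, Y)) (z : Z) : snd (lift h k z) = k z := rfl

namespace Hom

/-- Auxiliary: `a ↦ δ_a ⊗ ν`. -/
def strength (ν : Measure Y) [IsProbabilityMeasure ν] [ν.Regular] : Hom X (prod X Y) :=
  ofMeasure (fun a => ν.map fun b => toProd (a, b))
    (fun a => Measure.isProbabilityMeasure_map (measurable_toProd a).aemeasurable)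
    (fun a => regular_map ν ⟨fun b => toProd (a, b), by fun_prop⟩)
    (fun χ => by
      have h (a : X) : ∫ y, χ y ∂(ν.map fun b => toProd (a, b)) = ∫ b, (χ.comp toProd).curry a b ∂ν :=
        integral_map (measurable_toProd a).aemeasurable χ.continuous.aestronglyMeasurable
      simp_rw [h]
      exact (CHausStoch.continuous_integral ν).comp (χ.comp toProd).curry.continuous)

lemma strength_pull (ν : Measure Y) [IsProbabilityMeasure ν] [ν.Regular] (χ : C(prod X Y, ℝ))
    (a : X) : (strength ν).pull χ a = ∫ b, χ (toProd (a, b)) ∂ν :=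
  integral_map (measurable_toProd a).aemeasurable χ.continuous.aestronglyMeasurable

lemma tensor_aux (f : Hom X Y) (g : Hom X' Y') (χ : C(prod Y Y', ℝ)) (p : prod X X') :
    ∫ y, χ y ∂((f.kernel (fst p)).bind fun a => (g.kernel (snd p)).map fun b => toProd (a, b)) =
      ∫ a, ∫ b, χ (toProd (a, b)) ∂g.kernel (snd p) ∂f.kernel (fst p) := by
  have h := Kernel.integral_comp (κ := Kernel.const Unit (f.kernel (fst p)))
    (η := (strength (X := Y) (g.kernel (snd p))).kernel) (a := ())
    (integrable_continuousMap _ χ)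
  rw [Kernel.comp_apply, Kernel.const_apply] at h
  exact h.trans (integral_congr_ae (.of_forall fun a => strength_pull _ χ a))

/-- The value at `(x, y)` of the tensor product is the Radon product measure
`B ↦ ∫ a, g(y) {b | (a, b) ∈ B} ∂f(x)`. -/
def tensor (f : Hom X Y) (g : Hom X' Y') : Hom (prod X X') (prod Y Y') :=
  ofMeasure
    (fun p => (f.kernel (fst p)).bind fun a => (g.kernel (snd p)).map fun b => toProd (a, b))
    (fun p => inferInstanceAs <| IsProbabilityMeasure
      ((f.kernel (fst p)).bind (strength (X := Y) (g.kernel (snd p))).kernel))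
    (fun p => regular_bind _ (strength (X := Y) (g.kernel (snd p))).isMarkov.1 
      (strength (X := Y) (g.kernel (snd p))).regular
      (strength (X := Y) (g.kernel (snd p))).continuous_integral)
    (fun χ => by
      let G : C(Y, C(X', ℝ)) := g.pull.comp (χ.comp toProd).curry
      let G' : C(X', C(Y, ℝ)) := (G.uncurry.comp ⟨Prod.swap, continuous_swap⟩).curry
      let H : C(X', C(X, ℝ)) := f.pull.comp G'
      have h (p : prod X X') : ∫ y, χ y ∂((f.kernel (fst p)).bind fun a =>
          (g.kernel (snd p)).map fun b => toProd (a, b)) = H (snd p) (fst p) :=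
        tensor_aux f g χ p
      simp_rw [h]
      have := (H.uncurry.comp ⟨Prod.swap, continuous_swap⟩).continuous
      exact this)

lemma tensor_pull (f : Hom X Y) (g : Hom X' Y') (χ : C(prod Y Y', ℝ)) (p : prod X X') :
    (f.tensor g).pull χ p = ∫ a, ∫ b, χ (toProd (a, b)) ∂g.kernel (snd p) ∂f.kernel (fst p) :=
  tensor_aux f g χ p

/-- Product functions on a product space. -/
def mulFun (φ : C(X, ℝ)) (ψ : C(Y, ℝ)) : C(prod X Y, ℝ) := φ.comp fst * ψ.comp snd

@[simp]
lemma mulFun_apply (φ : C(X, ℝ)) (ψ : C(Y, ℝ)) (p : prod X Y) :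
    mulFun φ ψ p = φ (fst p) * ψ (snd p) := rfl

@[simp]
lemma tensor_pull_mul (f : Hom X Y) (g : Hom X' Y') (φ : C(Y, ℝ)) (ψ : C(Y', ℝ))
    (p : prod X X') :
    (f.tensor g).pull (mulFun φ ψ) p = f.pull φ (fst p) * g.pull ψ (snd p) := by
  rw [tensor_pull]
  simp [integral_const_mul, integral_mul_const, pull_apply]

lemma ext_mul {f g : Hom Z (prod X Y)}
    (h : ∀ φ ψ z, f.pull (mulFun φ ψ) z = g.pull (mulFun φ ψ) z) : f = g := by
  ext z : 2
  exact ext_of_integral_mul fst snd (fun _ _ => prod_ext) fun φ ψ => h φ ψ z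

lemma det_tensor_det (h : C(X, Y)) (k : C(X', Y')) :
    (det h).tensor (det k) = det (lift (h.comp fst) (k.comp snd)) :=
  ext_mul fun φ ψ p => by simp

lemma det_comp_det (h : C(X, Y)) (k : C(Y, Z)) : (det h).comp (det k) = det (k.comp h) :=
  ext_pull fun φ x => by simp

lemma tensor_comp_tensor {Z' : CHausStoch.{u}} (f : Hom X Y) (f' : Hom X' Y') (g : Hom Y Z)
    (g' : Hom Y' Z') :
    (f.tensor f').comp (g.tensor g') = (f.comp g).tensor (f'.comp g') :=
  ext_mul fun φ ψ p => by
    have : (g.tensor g').pull (mulFun φ ψ) = mulFun (g.pull φ) (g'.pull ψ) := by ext; simp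
    simp [this]

end Hom

end prod

/-- Homeomorphisms as isomorphisms. -/
def isoDet {X Y : CHausStoch.{u}} (h : C(X, Y)) (k : C(Y, X)) (hk : ∀ x, k (h x) = x)
    (kh : ∀ y, h (k y) = y) : X ≅ Y where
  hom := Hom.det h
  inv := Hom.det k
  hom_inv_id := (Hom.det_comp_det h k).trans (congrArg Hom.det (ContinuousMap.ext hk))
  inv_hom_id := (Hom.det_comp_det k h).trans (congrArg Hom.det (ContinuousMap.ext kh))

instance : MonoidalCategoryStruct CHausStoch.{u} where
  tensorObj := prod
  tensorHom f g := Hom.tensor f g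
  whiskerLeft X _ _ f := Hom.tensor (𝟙 X) f
  whiskerRight f X := Hom.tensor f (𝟙 X)
  tensorUnit := of PUnit
  associator _ _ _ := isoDet
    (lift (fst.comp fst) (lift (snd.comp fst) snd)) (lift (lift fst (fst.comp snd)) (snd.comp snd))
    (fun _ => rfl) (fun _ => rfl)
  leftUnitor X := isoDet snd (lift (.const X PUnit.unit) (.id X)) (fun _ => rfl) (fun _ => rfl)
  rightUnitor X := isoDet fst (lift (.id X) (.const X PUnit.unit)) (fun _ => rfl) (fun _ => rfl)

variable {X X' Y Y' Z : CHausStoch.{u}}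

lemma id_def : 𝟙 X = Hom.det (.id X) := rfl

lemma comp_def (f : X ⟶ Y) (g : Y ⟶ Z) : f ≫ g = Hom.comp f g := rfl

lemma tensorHom_eq (f : X ⟶ Y) (g : X' ⟶ Y') : f ⊗ₘ g = Hom.tensor f g := rfl

lemma whiskerLeft_eq (f : Y ⟶ Z) : X ◁ f = Hom.tensor (Hom.det (.id X)) f := rfl

lemma whiskerRight_eq (f : Y ⟶ Z) : f ▷ X = Hom.tensor f (Hom.det (.id X)) := rfl

lemma associator_hom : (α_ X Y Z).hom =
    Hom.det (lift (fst.comp fst) (lift (snd.comp fst) snd)) := rfl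

lemma associator_inv : (α_ X Y Z).inv =
    Hom.det (lift (lift fst (fst.comp snd)) (snd.comp snd)) := rfl

lemma leftUnitor_hom : (λ_ X).hom = Hom.det snd := rfl

lemma leftUnitor_inv : (λ_ X).inv = Hom.det (lift (.const X PUnit.unit) (.id X)) := rfl

lemma rightUnitor_hom : (ρ_ X).hom = Hom.det fst := rfl

lemma rightUnitor_inv : (ρ_ X).inv = Hom.det (lift (.id X) (.const X PUnit.unit)) := rfl

instance : MonoidalCategory CHausStoch.{u} := .ofTensorHom
  (id_tensorHom_id := fun _ _ => Hom.det_tensor_det _ _)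
  (id_tensorHom := fun _ _ _ _ => rfl)
  (tensorHom_id := fun _ _ => rfl)
  (tensorHom_comp_tensorHom := fun f f' g g' => Hom.tensor_comp_tensor f f' g g')
  (associator_naturality := fun f g h => by
    simp only [comp_def, tensorHom_eq, associator_hom]
    refine Hom.ext_mul fun φ χ p => ?_
    rw [Hom.comp_pull, Hom.comp_pull, Hom.comp_det_pull, Hom.det_pull, Hom.tensor_pull_mul,
      Hom.tensor_pull, Hom.tensor_pull]
    refine Eq.trans ?_ ((Hom.tensor_pull_mul f g φ
      ((Hom.strength (h.kernel (snd p))).pull χ) (fst p)).trans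
      (congrArg _ (integral_congr_ae (.of_forall fun b => Hom.strength_pull _ χ b))))
    refine integral_congr_ae (.of_forall fun q => ?_)
    rw [Hom.mulFun_apply, Hom.strength_pull]
    exact integral_const_mul (φ (fst q)) fun b => χ (toProd (snd q, b)))
  (leftUnitor_naturality := fun f => by
    simp only [comp_def, tensorHom_eq, leftUnitor_hom]
    refine Hom.ext_pull fun φ p => ?_
    rw [Hom.comp_pull, Hom.comp_pull, Hom.det_pull, Hom.comp_det_pull, Hom.tensor_pull]
    simp [Hom.pull_apply])
  (rightUnitor_naturality := fun f => by
    simp only [comp_def, tensorHom_eq, rightUnitor_hom]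
    refine Hom.ext_pull fun φ p => ?_
    rw [Hom.comp_pull, Hom.comp_pull, Hom.det_pull, Hom.comp_det_pull, Hom.tensor_pull]
    simp [Hom.pull_apply])
  (pentagon := fun W X Y Z => by
    simp only [comp_def, tensorHom_eq, associator_hom, id_def, Hom.det_tensor_det,
      Hom.det_comp_det]
    rfl)
  (triangle := fun X Y => by
    simp only [comp_def, tensorHom_eq, associator_hom, leftUnitor_hom, rightUnitor_hom, id_def,
      Hom.det_tensor_det, Hom.det_comp_det]
    rfl)

instance : SymmetricCategory CHausStoch.{u} where
  braiding X Y := isoDet (lift snd fst) (lift snd fst) (fun _ => rfl) (fun _ => rfl)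
  braiding_naturality_right X Y Z f := by
    simp only [comp_def, whiskerLeft_eq, whiskerRight_eq, isoDet]
    refine Hom.ext_mul fun φ ψ p => ?_
    rw [Hom.comp_pull, Hom.comp_pull, Hom.det_pull, Hom.tensor_pull_mul, Hom.comp_det_pull]
    refine Eq.trans ?_ ((Hom.tensor_pull_mul _ _ ψ φ p).trans (mul_comm _ _))
    exact congrArg (fun χ => (Hom.tensor _ _).pull χ p) (ContinuousMap.ext fun q => mul_comm _ _)
  braiding_naturality_left f X := by
    simp only [comp_def, whiskerLeft_eq, whiskerRight_eq, isoDet]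
    refine Hom.ext_mul fun φ ψ p => ?_
    rw [Hom.comp_pull, Hom.comp_pull, Hom.det_pull, Hom.tensor_pull_mul, Hom.comp_det_pull]
    refine Eq.trans ?_ ((Hom.tensor_pull_mul _ _ ψ φ p).trans (mul_comm _ _))
    exact congrArg (fun χ => (Hom.tensor _ _).pull χ p) (ContinuousMap.ext fun q => mul_comm _ _)
  hexagon_forward X Y Z := by
    simp only [comp_def, whiskerLeft_eq, whiskerRight_eq, isoDet, associator_hom,
      Hom.det_tensor_det, Hom.det_comp_det]
    rfl
  hexagon_reverse X Y Z := by
    simp only [comp_def, whiskerLeft_eq, whiskerRight_eq, isoDet, associator_inv,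
      Hom.det_tensor_det, Hom.det_comp_det]
    rfl
  symmetry X Y := by
    simp only [comp_def, isoDet, id_def, Hom.det_comp_det]
    rfl

lemma braiding_hom : (β_ X Y).hom = Hom.det (lift snd fst) := rfl

/-- Copying and discarding. -/
instance : ComonObj X where
  counit := Hom.det (.const X PUnit.unit)
  comul := Hom.det (lift (.id X) (.id X))
  counit_comul := by
    simp only [comp_def, whiskerRight_eq, leftUnitor_inv, Hom.det_tensor_det, Hom.det_comp_det]
    rfl
  comul_counit := by
    simp only [comp_def, whiskerLeft_eq, rightUnitor_inv, Hom.det_tensor_det, Hom.det_comp_det]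
    rfl
  comul_assoc := by
    simp only [comp_def, whiskerLeft_eq, whiskerRight_eq, associator_hom, Hom.det_tensor_det,
      Hom.det_comp_det]
    rfl

open scoped ComonObj

lemma copy_def : Δ[X] = Hom.det (lift (.id X) (.id X)) := rfl

lemma discard_def : ε[X] = Hom.det (.const X PUnit.unit) := rfl

instance : MarkovCategory CHausStoch.{u} where
  comonObj _ := inferInstance
  isCommComonObj X := ⟨by
    simp only [comp_def, copy_def, braiding_hom, Hom.det_comp_det]
    rfl⟩
  copy_tensor X Y := by
    simp only [tensorμ, comp_def, copy_def, braiding_hom, tensorHom_eq, whiskerLeft_eq,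
      whiskerRight_eq, associator_hom, associator_inv, Hom.det_tensor_det, Hom.det_comp_det]
    rfl
  discard_tensor X Y := by
    simp only [comp_def, discard_def, tensorHom_eq, leftUnitor_hom, Hom.det_tensor_det,
      Hom.det_comp_det]
    rfl
  copy_unit := rfl
  discard_unit := rfl
  discard_natural f := Hom.ext_pull fun φ x => by
    rw [comp_def, discard_def, discard_def, Hom.comp_pull, Hom.comp_det_pull, Hom.det_pull]
    simp [Hom.pull_apply]

end CHausStoch

end

namespace CategoryTheory

open MonoidalCategory ComonObj

/-- An endomorphism `e` in a Markov category is a balanced idempotent if, in the two-step Markov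
chain with transition kernel `e`, replacing the intermediate value by a second independent
sample from its transition does not change the joint distribution:
`(e ⊗ id) ∘ copy ∘ e = (e ⊗ e) ∘ copy ∘ e`. -/
def IsBalanced {C : Type*} [Category* C] [MonoidalCategory C] [MarkovCategory C] {X : C}
    (e : X ⟶ X) : Prop :=
  e ≫ Δ[X] ≫ (e ⊗ₘ 𝟙 X) = e ≫ Δ[X] ≫ (e ⊗ₘ e)

end CategoryTheory

/-! Let `E = e.pull` be the positive unital idempotent operator on `C(X, ℝ)` given by integration
against `e`. The form `(φ, ψ) ↦ E (φ ψ) - E (Eφ Eψ)` is `E` applied to a conditional covariance,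
hence positive semidefinite. A function `f` in the image of `E` is isotropic for it, hence
orthogonal to everything: `E (f ψ) = E (f Eψ)` (`Hom.pull_mul_pull`). This is balancedness tested on
product functions, which determine a kernel into a product.

For the splitting, let `S = detSet e` be the closed set of points `x` at which every `f = Eφ` has
zero variance under `e(x)`. The variance `E (f²) - f²` is nonnegative and `E` kills it, so every
`e(x)` is concentrated on `S` (`ae_mem_detSet`). For `a` in `S`, each `f` is almost surely equal to
its mean `f(a)` under `e(a)`, so `e(a)` is concentrated on the points of `S` with the same kernel as
`a` (`ae_pull_eq_of_mem_detSet`). Let `T` be `S` with points of equal kernel identified. The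
inclusion sends a class to its common kernel, and the projection is `e` followed by the quotient
map. One composite is `e ∘ e = e`; the other is the identity because `e(a)` lives on the class of
`a`. -/

namespace CHausStoch

open MeasureTheory ProbabilityTheory
open scoped ENNReal

/-! ### Radon measures and closed subsets -/

/-- A Radon measure is `τ`-additive: a union of open null sets is null, stated here for the
complements of a family of closed sets. -/
lemma ae_all_mem_of_isClosed {X ι : Type*} [TopologicalSpace X] [MeasurableSpace X] [BorelSpace X]
    (μ : Measure X) [μ.Regular] {C : ι → Set X} (hC : ∀ i, IsClosed (C i))
    (h : ∀ i, ∀ᵐ x ∂μ, x ∈ C i) : ∀ᵐ x ∂μ, ∀ i, x ∈ C i := by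
  have hU : IsOpen (⋃ i, (C i)ᶜ) := isOpen_iUnion fun i => (hC i).isOpen_compl
  have hset : {x | ¬ ∀ i, x ∈ C i} = ⋃ i, (C i)ᶜ := by ext x; simp
  -- The index set may be uncountable, so countable subadditivity is not available. Inner regularity
  -- reduces to compact sets, on which local nullity suffices.
  rw [ae_iff, hset, hU.measure_eq_iSup_isCompact]
  simp only [ENNReal.iSup_eq_zero]
  intro K hKU hK
  refine hK.measure_zero_of_nhdsWithin fun x hx => ?_
  obtain ⟨i, hi⟩ := Set.mem_iUnion.1 (hKU hx)
  exact ⟨_, mem_nhdsWithin_of_mem_nhds ((hC i).isOpen_compl.mem_nhds hi), h i⟩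

section comap

variable {X : Type*} [TopologicalSpace X] [CompactSpace X] [T2Space X] [MeasurableSpace X]
  [BorelSpace X] {S : Set X}

lemma regular_comap_subtype (μ : Measure X) [IsFiniteMeasure μ] [μ.Regular] (hS : IsClosed S) :
    (μ.comap ((↑) : S → X)).Regular := by
  have : CompactSpace S := isCompact_iff_compactSpace.1 hS.isCompact
  have hemb := MeasurableEmbedding.subtype_coe hS.measurableSet
  have hfin : IsFiniteMeasure (μ.comap ((↑) : S → X)) :=
    ⟨by rw [hemb.comap_apply]; exact measure_lt_top μ _⟩
  refine regular_of_innerRegularWRT _ fun U hU r hr => ?_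
  rw [hemb.comap_apply] at hr
  -- The image of `U` is Borel in `X` but need not be open; finiteness of `μ` gives compact
  -- approximation of it all the same.
  obtain ⟨K, hKU, hK, hr⟩ := (hemb.measurableSet_image.2 hU.measurableSet).exists_lt_isCompact_of_ne_top
    (measure_ne_top μ _) hr
  have hKS : K ⊆ Set.range ((↑) : S → X) := hKU.trans (Set.image_subset_range _ _)
  refine ⟨(↑) ⁻¹' K, ?_, hK.isClosed.preimage continuous_subtype_val, ?_⟩
  · intro s hs
    obtain ⟨s', hs', h⟩ := hKU hs
    rwa [← Subtype.ext h]
  · rwa [hemb.comap_apply, Set.image_preimage_eq_of_subset hKS]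

lemma isProbabilityMeasure_comap_subtype (μ : Measure X) [IsProbabilityMeasure μ]
    (hS : IsClosed S) (h : ∀ᵐ x ∂μ, x ∈ S) :
    IsProbabilityMeasure (μ.comap ((↑) : S → X)) := by
  constructor
  rw [(MeasurableEmbedding.subtype_coe hS.measurableSet).comap_apply, Set.image_univ,
    Subtype.range_coe]
  exact (prob_compl_eq_zero_iff hS.measurableSet).1 h

lemma integral_comap_subtype (μ : Measure X) (hS : IsClosed S) (h : ∀ᵐ x ∂μ, x ∈ S)
    (φ : X → ℝ) : ∫ s : S, φ s ∂μ.comap ((↑) : S → X) = ∫ x, φ x ∂μ := by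
  rw [integral_subtype_comap hS.measurableSet, Measure.restrict_eq_self_of_ae_mem h]

end comap

/-! ### The Markov operator of a kernel and its variance -/

namespace Hom

variable {X Y : CHausStoch.{u}}

lemma pull_add (f : Hom X Y) (φ ψ : C(Y, ℝ)) : f.pull (φ + ψ) = f.pull φ + f.pull ψ := by
  ext x
  exact integral_add (integrable_continuousMap _ φ) (integrable_continuousMap _ ψ)

lemma pull_sub (f : Hom X Y) (φ ψ : C(Y, ℝ)) : f.pull (φ - ψ) = f.pull φ - f.pull ψ := by
  ext x
  exact integral_sub (integrable_continuousMap _ φ) (integrable_continuousMap _ ψ)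

lemma pull_smul (f : Hom X Y) (c : ℝ) (φ : C(Y, ℝ)) : f.pull (c • φ) = c • f.pull φ := by
  ext x
  exact integral_const_mul c φ

lemma pull_one (f : Hom X Y) : f.pull 1 = 1 := by
  ext x
  simp [pull_apply]

lemma pull_nonneg (f : Hom X Y) {φ : C(Y, ℝ)} (h : ∀ y, 0 ≤ φ y) (x : X) :
    0 ≤ f.pull φ x :=
  integral_nonneg h

/-- The variance is the second moment about the mean. -/
lemma pull_sub_const_mul_self (f : Hom X Y) (φ : C(Y, ℝ)) (x : X) :
    f.pull ((φ - (f.pull φ x) • 1) * (φ - (f.pull φ x) • 1)) x =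
      f.pull (φ * φ) x - f.pull φ x * f.pull φ x := by
  have h : (φ - (f.pull φ x) • 1) * (φ - (f.pull φ x) • 1) =
      φ * φ - (2 * f.pull φ x) • φ + (f.pull φ x * f.pull φ x) • (1 : C(Y, ℝ)) := by
    ext y
    simp
    ring
  rw [h, pull_add, pull_sub, pull_smul, pull_smul, pull_one]
  simp
  ring

lemma mul_self_pull_le (f : Hom X Y) (φ : C(Y, ℝ)) (x : X) :
    f.pull φ x * f.pull φ x ≤ f.pull (φ * φ) x := by
  have := f.pull_nonneg (φ := (φ - (f.pull φ x) • 1) * (φ - (f.pull φ x) • 1))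
    (fun y => mul_self_nonneg _) x
  rw [pull_sub_const_mul_self] at this
  simpa using this

/-- If a nonnegative continuous function has integral zero, it vanishes almost everywhere. -/
lemma ae_eq_zero_of_pull_eq_zero (f : Hom X Y) {φ : C(Y, ℝ)} (h : ∀ y, 0 ≤ φ y) {x : X}
    (hx : f.pull φ x = 0) : ∀ᵐ y ∂f.kernel x, φ y = 0 :=
  (integral_eq_zero_iff_of_nonneg h (integrable_continuousMap _ φ)).1 hx

end Hom

/-! ### Idempotent Markov operators -/

section Idempotent

variable {X : CHausStoch.{u}} {e : Hom X X}

/-- A function `f` fixed by an idempotent Markov operator `E` satisfies `E (f ψ) = E (f (E ψ))`: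
the form `(φ, ψ) ↦ E (φ ψ) - E (E φ E ψ)` is positive semidefinite and `f` is isotropic for it. -/
lemma Hom.pull_mul_pull (he : ∀ φ, e.pull (e.pull φ) = e.pull φ) (φ ψ : C(X, ℝ)) :
    e.pull (e.pull φ * ψ) = e.pull (e.pull φ * e.pull ψ) := by
  ext x
  set f := e.pull φ with hf
  have hff : e.pull f = f := he φ
  have key (t : ℝ) : 0 ≤ (e.pull (ψ * ψ) x - e.pull (e.pull ψ * e.pull ψ) x) +
      2 * t * (e.pull (f * ψ) x - e.pull (f * e.pull ψ) x) := by
    -- The quadratic form at `ψ + t • f`. Since `E f = f`, its `t²` term cancels, leaving an affine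
    -- function of `t` that is nonnegative everywhere, so its slope must vanish.
    have h := e.pull_nonneg (φ := e.pull ((ψ + t • f) * (ψ + t • f)) -
      e.pull (ψ + t • f) * e.pull (ψ + t • f))
      (fun y => sub_nonneg.2 (e.mul_self_pull_le (ψ + t • f) y)) x
    have h1 : (ψ + t • f) * (ψ + t • f) = ψ * ψ + (2 * t) • (f * ψ) + (t * t) • (f * f) := by
      ext y; simp; ring
    have h2 : (e.pull ψ + t • f) * (e.pull ψ + t • f) =
        e.pull ψ * e.pull ψ + (2 * t) • (f * e.pull ψ) + (t * t) • (f * f) := by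
      ext y; simp; ring
    rw [e.pull_sub, he, pull_add, pull_smul, hff, h1, h2] at h
    simp only [pull_add, pull_smul, ContinuousMap.sub_apply, ContinuousMap.add_apply,
      ContinuousMap.smul_apply, smul_eq_mul] at h
    linarith
  set c := e.pull (ψ * ψ) x - e.pull (e.pull ψ * e.pull ψ) x
  set d := e.pull (f * ψ) x - e.pull (f * e.pull ψ) x with hd
  by_contra hne
  have hd0 : d ≠ 0 := sub_ne_zero.2 hne
  -- This `t` gives the affine function the value `-1`.
  have := key (-(c + 1) / (2 * d))
  have h3 : 2 * (-(c + 1) / (2 * d)) * d = -(c + 1) := by field_simp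
  linarith

variable (e) in
/-- The points from whose transition kernel the functions in the image of `e` have zero
variance. -/
def detSet : Set X :=
  {x | ∀ φ, e.pull (e.pull φ * e.pull φ) x - e.pull φ x * e.pull φ x = 0}

lemma isClosed_detSet : IsClosed (detSet e) := by
  simp only [detSet, Set.ofPred_forall]
  exact isClosed_iInter fun φ => isClosed_eq (by fun_prop) continuous_const

/-- For each `φ` the defining expression is a nonnegative function whose integral against `e(x)` is
zero by idempotence. The defining conditions are closed, so `τ`-additivity lets all `φ` be treated
at once. -/
lemma ae_mem_detSet (he : ∀ φ, e.pull (e.pull φ) = e.pull φ) (x : X) :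
    ∀ᵐ y ∂e.kernel x, y ∈ detSet e := by
  refine ae_all_mem_of_isClosed _ (fun φ => isClosed_eq (by fun_prop) continuous_const)
    fun φ => ?_
  refine e.ae_eq_zero_of_pull_eq_zero
    (φ := e.pull (e.pull φ * e.pull φ) - e.pull φ * e.pull φ) ?_ ?_
  · intro y
    have := e.mul_self_pull_le (e.pull φ) y
    rw [he] at this
    exact sub_nonneg.2 this
  · rw [e.pull_sub, he, sub_self]
    rfl

/-- From a point of `detSet e`, the transition kernel is concentrated on the points which the
functions in the image of `e` do not distinguish from it. -/
lemma ae_pull_eq_of_mem_detSet (he : ∀ φ, e.pull (e.pull φ) = e.pull φ) {x : X}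
    (hx : x ∈ detSet e) : ∀ᵐ y ∂e.kernel x, ∀ φ, e.pull φ y = e.pull φ x := by
  refine ae_all_mem_of_isClosed (C := fun φ => {y | e.pull φ y = e.pull φ x}) _
    (fun φ => isClosed_eq (by fun_prop) continuous_const) fun φ => ?_
  -- By idempotence the mean of `Eφ` under `e(x)` is `Eφ (x)`; membership in `detSet e` says that
  -- the variance is zero.
  have h := e.pull_sub_const_mul_self (e.pull φ) x
  rw [he, hx φ] at h
  filter_upwards [e.ae_eq_zero_of_pull_eq_zero (fun y => mul_self_nonneg _) h] with y hy
  have := mul_self_eq_zero.1 hy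
  simpa [sub_eq_zero] using this

/-! ### The splitting object -/

variable (e) in
/-- Two points of `detSet e` are identified if their transition kernels agree. -/
def splitSetoid : Setoid (detSet e) where
  r a b := ∀ φ, e.pull φ a = e.pull φ b
  iseqv := ⟨fun _ _ => rfl, fun h φ => (h φ).symm, fun h h' φ => (h φ).trans (h' φ)⟩

variable (e) in
/-- The points of the splitting object. -/
def SplitSpace : Type u := Quotient (splitSetoid e)

instance : TopologicalSpace (SplitSpace e) :=
  inferInstanceAs (TopologicalSpace (Quotient (splitSetoid e)))

instance : CompactSpace (SplitSpace e) :=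
  have : CompactSpace (detSet e) := isCompact_iff_compactSpace.1 isClosed_detSet.isCompact
  inferInstanceAs (CompactSpace (Quotient (splitSetoid e)))

/-- The functions in the image of `e`, on the splitting object. -/
noncomputable def splitFun (φ : C(X, ℝ)) : C(SplitSpace e, ℝ) where
  toFun := Quotient.lift (fun a : detSet e => e.pull φ a) fun _ _ h => h φ
  continuous_toFun := Continuous.quotient_lift (by fun_prop) _

/-- The functions `Eφ` separate classes by construction, so they inject the quotient continuously
into a power of `ℝ`. -/
instance : T2Space (SplitSpace e) := by
  refine T2Space.of_injective_continuous
    (f := fun (t : SplitSpace e) (φ : C(X, ℝ)) => splitFun φ t) ?_ (by fun_prop)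
  rintro ⟨a⟩ ⟨b⟩ h
  exact Quotient.sound fun φ => congrFun h φ

variable (e) in
/-- The splitting object. -/
def splitObj : CHausStoch.{u} := of (SplitSpace e)

variable (e) in
/-- The quotient map onto the splitting object. -/
def splitMk : C(detSet e, splitObj e) :=
  ⟨fun a => (Quotient.mk (splitSetoid e) a : SplitSpace e), continuous_quotient_mk'⟩

lemma splitMk_surjective : Function.Surjective (splitMk e) := Quotient.mk_surjective

lemma kernel_eq_of_rel {a b : X} (h : ∀ φ, e.pull φ a = e.pull φ b) :
    e.kernel a = e.kernel b :=
  ext_of_integral h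

/-! ### The splitting morphisms -/

variable (e) in
/-- The inclusion: a class is sent to the common transition kernel of its elements. -/
noncomputable def splitInclusion : Hom (splitObj e) X :=
  Hom.ofMeasure
    (Quotient.lift (s := splitSetoid e) (fun a : detSet e => e.kernel a)
      fun _ _ h => kernel_eq_of_rel h)
    (by rintro ⟨a⟩; exact inferInstanceAs (IsProbabilityMeasure (e.kernel a)))
    (by rintro ⟨a⟩; exact e.regular a)
    (fun φ => by
      refine (splitFun (e := e) φ).continuous.congr ?_
      rintro ⟨a⟩
      rfl)

lemma splitInclusion_kernel (a : detSet e) :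
    (splitInclusion e).kernel (splitMk e a) = e.kernel a := rfl

/-- Tietze extension from the closed set `detSet e`. It turns integrals over the quotient into
values of `E` on `C(X, ℝ)`, whence the continuity of the projection. -/
lemma exists_extension_splitMk (φ : C(splitObj e, ℝ)) :
    ∃ ψ : C(X, ℝ), ∀ a : detSet e, ψ a = φ (splitMk e a) := by
  obtain ⟨ψ, hψ⟩ := (φ.comp (splitMk e)).exists_restrict_eq isClosed_detSet
  exact ⟨ψ, fun a => DFunLike.congr_fun hψ a⟩

/-- The values of `ψ` off `detSet e` do not matter, since `e(x)` is concentrated there. -/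
lemma integral_map_splitMk (he : ∀ φ, e.pull (e.pull φ) = e.pull φ) (x : X)
    {φ : C(splitObj e, ℝ)} {ψ : C(X, ℝ)} (h : ∀ a : detSet e, ψ a = φ (splitMk e a)) :
    ∫ t, φ t ∂((e.kernel x).comap ((↑) : detSet e → X)).map (splitMk e) = e.pull ψ x := by
  rw [integral_map (splitMk e).continuous.measurable.aemeasurable
    φ.continuous.aestronglyMeasurable]
  simp_rw [← h]
  exact integral_comap_subtype _ isClosed_detSet (ae_mem_detSet he x) ψ

/-- The projection: transition along `e`, followed by the quotient map. -/
noncomputable def splitProjection (he : ∀ φ, e.pull (e.pull φ) = e.pull φ) : Hom X (splitObj e) :=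
  Hom.ofMeasure (fun x => ((e.kernel x).comap ((↑) : detSet e → X)).map (splitMk e))
    (fun x =>
      have := isProbabilityMeasure_comap_subtype (e.kernel x) isClosed_detSet (ae_mem_detSet he x)
      Measure.isProbabilityMeasure_map (splitMk e).continuous.measurable.aemeasurable)
    (fun x =>
      have : CompactSpace (detSet e) := isCompact_iff_compactSpace.1 isClosed_detSet.isCompact
      have := isProbabilityMeasure_comap_subtype (e.kernel x) isClosed_detSet (ae_mem_detSet he x)
      have := regular_comap_subtype (e.kernel x) (isClosed_detSet (e := e))
      regular_map _ _)
    (fun φ => by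
      obtain ⟨ψ, hψ⟩ := exists_extension_splitMk φ
      simp_rw [integral_map_splitMk he _ hψ]
      exact (e.pull ψ).continuous)

lemma splitProjection_pull (he : ∀ φ, e.pull (e.pull φ) = e.pull φ) (x : X)
    {φ : C(splitObj e, ℝ)} {ψ : C(X, ℝ)} (h : ∀ a : detSet e, ψ a = φ (splitMk e a)) :
    (splitProjection he).pull φ x = e.pull ψ x :=
  integral_map_splitMk he x h

lemma splitProjection_comp_splitInclusion (he : ∀ φ, e.pull (e.pull φ) = e.pull φ) :
    (splitProjection he).comp (splitInclusion e) = e :=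
  Hom.ext_pull fun φ x => by
    -- Pulled back along the inclusion, `φ` becomes the function induced by `Eφ` on classes, so `Eφ`
    -- itself serves as the extension.
    rw [Hom.comp_pull, splitProjection_pull he x (ψ := e.pull φ) fun _ => rfl, he]

lemma splitInclusion_comp_splitProjection (he : ∀ φ, e.pull (e.pull φ) = e.pull φ) :
    (splitInclusion e).comp (splitProjection he) = Hom.det (.id _) :=
  Hom.ext_pull fun φ t => by
    obtain ⟨a, rfl⟩ := splitMk_surjective t
    obtain ⟨ψ, hψ⟩ := exists_extension_splitMk φ
    rw [Hom.comp_pull, Hom.det_pull, ContinuousMap.id_apply, ← hψ]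
    have h : (splitInclusion e).pull ((splitProjection he).pull φ) (splitMk e a) =
        e.pull (e.pull ψ) a := by
      rw [Hom.pull_apply, splitInclusion_kernel, Hom.pull_apply]
      exact integral_congr_ae (.of_forall fun y => splitProjection_pull he y hψ)
    rw [h, he, Hom.pull_apply]
    -- `e(a)` is concentrated on the class of `a`, where `ψ` is constant because on `detSet e` it
    -- factors through the quotient.
    have hae : ∀ᵐ y ∂e.kernel a, ψ y = ψ a := by
      filter_upwards [ae_mem_detSet he a, ae_pull_eq_of_mem_detSet he a.2] with y hy hya
      have : splitMk e ⟨y, hy⟩ = splitMk e a := Quotient.sound hya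
      rw [hψ a, ← this, ← hψ]
    rw [integral_congr_ae hae]
    simp

/-! ### Balancedness -/

lemma isBalanced_of_pull (he : ∀ φ, e.pull (e.pull φ) = e.pull φ) :
    IsBalanced (C := CHausStoch.{u}) e := by
  simp only [IsBalanced, comp_def, tensorHom_eq, copy_def, id_def]
  refine Hom.ext_mul fun φ ψ x => ?_
  -- With `g` the identity or `e`, the two sides of the balance equation become `E (Eφ · ψ)` and `E
  -- (Eφ · Eψ)`.
  have h (g : Hom X X) : (e.comp ((Hom.det (lift (.id X) (.id X))).comp (e.tensor g))).pull
      (Hom.mulFun φ ψ) x = e.pull (e.pull φ * g.pull ψ) x := by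
    rw [Hom.comp_pull]
    exact congrArg (fun χ => e.pull χ x) (ContinuousMap.ext fun y => by simp)
  rw [h, h, Hom.id_pull, Hom.pull_mul_pull he]

end Idempotent

end CHausStoch

open CHausStoch in
theorem mainTheorem9 (X : CHausStoch.{u}) (e : X ⟶ X) (he : e ≫ e = e) :
    IsBalanced e ∧
      ∃ (T : CHausStoch.{u}) (π : X ⟶ T) (ι : T ⟶ X), π ≫ ι = e ∧ ι ≫ π = 𝟙 T := by
  have hp (φ : C(X, ℝ)) : Hom.pull e (Hom.pull e φ) = Hom.pull e φ := by
    ext x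
    rw [← Hom.comp_pull, ← comp_def, he]
  exact ⟨isBalanced_of_pull hp, splitObj e, splitProjection hp, splitInclusion e,
    splitProjection_comp_splitInclusion hp, splitInclusion_comp_splitProjection hp⟩
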